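/- Let $k$ be a subfield of $\mathbb C$. Let $A$ be a graded set of letters, each of positive degree, with finitely many letters in each degree. Let $[\cdot,\cdot]$ be an operation on $\bar A=A\cup\{0\}$ such that $[a,0]=0$, $[a,b]=[b,a]$ and $[[a,b],c]=[a,[b,c]]$ for all $a,b,c\in\bar A$, and such that for all $a,b\in A$ either $[a,b]=0$ or $|[a,b]|=|a|+|b|$. For a nonempty sequence of letters put $[a_1]=a_1$ and $[a_1,a_2,\dots,a_n]=[a_1,[a_2,\dots,a_n]]$. Let $\mathfrak A=k\langle A\rangle$, with the words in $A$ as basis (the empty word is $1$), carry the quasi-shuffle product $*$, the bilinear product with $1*w=w*1=w$ and $$aw_1*bw_2=a(w_1*bw_2)+b(aw_1*w_2)+[a,b](w_1*w_2)$$ for letters $a,b$ and words $w,w_1,w_2$. Let $\mathfrak A^*$ be the graded dual of $\mathfrak A$, with basis $\{w^*\}$ dual to the words, with the concatenation product $u^*v^*=(uv)^*$ (with unit $1^*$, again written $1$) and the comultiplication $$\delta'(w^*)=\sum_{u,v\text{ words}}(u*v,w^*)\,u^*\otimes v^*,$$ where $(\cdot,\cdot)$ is the pairing of $\mathfrak A$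 with $\mathfrak A^*$. Let $\log^*$ be the algebra endomorphism of $(\mathfrak A^*,\mathrm{conc})$ with $$\log^*(a^*)=\sum_{n\ge1}\frac{(-1)^{n-1}}{n}\sum_{[a_1,\dots,a_n]=a}(a_1\cdots a_n)^*\qquad(a\in A),$$ the inner sum being over sequences of letters $a_1,\dots,a_n$. Let the set of Lie polynomials be the smallest $k$-subspace of $\mathfrak A^*$ that contains all $a^*$, $a\in A$, and is closed under $(P,Q)\mapsto PQ-QP$. Theorem 4.2. The primitive elements for $\delta'$, that is, the $x\in\mathfrak A^*$ with $\delta'(x)=x\otimes1+1\otimes x$, are exactly the elements $\log^*(P)$ with $P$ a Lie polynomial. -/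

import Mathlib

open scoped TensorProduct

noncomputable section

/-- A locally finite graded set `A` of letters (all degrees positive, finitely many letters in each
degree) with an operation `[·,·]` on `Ā = A ∪ {0}` satisfying (S0)-(S3). Here `Ā` is
`WithZero A`. -/
structure QuasiShuffleDatum (A : Type*) where
  /-- the degree `|a|` of a letter -/
  deg : A → ℕ
  deg_pos : ∀ a, 0 < deg a
  locallyFinite : ∀ n, {a | deg a = n}.Finite
  /-- the operation `[·,·]` -/
  br : WithZero A → WithZero A → WithZero A
  br_zero : ∀ a, br a 0 = 0
  br_comm : ∀ a b, br a b = br b a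
  br_assoc : ∀ a b c, br (br a b) c = br a (br b c)
  deg_br : ∀ a b : A, br a b = 0 ∨ ∃ c : A, br a b = c ∧ deg c = deg a + deg b

/-- The vector space of noncommutative polynomials in the letters `A`, with the words
(finite lists of letters) as basis. -/
abbrev NCPoly (k A : Type*) [Field k] : Type _ := List A →₀ k

/-- The graded dual with its concatenation product: it has a basis of elements `w*`, one for each
word `w`, multiplied by `u* v* = (uv)*`. See `QuasiShuffle.range_pairing` for the
identification with the functionals vanishing in all but finitely many degrees. -/
abbrev NCDual (k A : Type*) [Field k] : Type _ := MonoidAlgebra k (FreeMonoid A)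

namespace QuasiShuffle

/-- Left multiplication `x ↦ ax` by an element `a ∈ Ā` (a letter or zero). -/
def prepend (k : Type*) {A : Type*} [Field k] : WithZero A → NCPoly k A →ₗ[k] NCPoly k A
  | none => 0
  | some a => Finsupp.lmapDomain k k (List.cons a)

/-- The basis element `w*` of the graded dual. -/
def dualWord (k : Type*) {A : Type*} [Field k] (w : List A) : NCDual k A :=
  MonoidAlgebra.single (FreeMonoid.ofList w) 1

/-- The bilinear pairing with `(u, v*) = 1` if `u = v` and `0` otherwise. -/
def pairing (k A : Type*) [Field k] : NCPoly k A →ₗ[k] NCDual k A →ₗ[k] k :=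
  Finsupp.lsum k fun w => LinearMap.toSpanSingleton k _
    { toFun := fun P => P.coeff (FreeMonoid.ofList w)
      map_add' := fun P Q => by simp
      map_smul' := fun c P => by simp }

/-- The quasi-shuffle product of two words:
`1 * w = w * 1 = w`, `a u * b v = a (u * b v) + b (a u * v) + [a,b] (u * v)`. -/
def wordMul (k : Type*) {A : Type*} [Field k] (D : QuasiShuffleDatum A) :
    List A → List A → NCPoly k A
  | [], v => Finsupp.single v 1
  | a :: u, [] => Finsupp.single (a :: u) 1
  | a :: u, b :: v =>
      prepend k (a : WithZero A) (wordMul k D u (b :: v)) +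
      prepend k (b : WithZero A) (wordMul k D (a :: u) v) +
      prepend k (D.br a b) (wordMul k D u v)
termination_by u v => u.length + v.length

/-- The degree of a word: the sum of the degrees of its letters. -/
def wordDeg {A : Type*} (D : QuasiShuffleDatum A) (w : List A) : ℕ := (w.map D.deg).sum

/-- `[S]` for a nonempty sequence `S`: `[a] = a` and `[a, S] = [a, [S]]`. (The value at the empty
sequence is never used; it is set to `0`.) -/
def brSeq {A : Type*} (D : QuasiShuffleDatum A) : List A → WithZero A
  | [] => 0
  | [a] => a
  | a :: b :: S => D.br a (brSeq D (b :: S))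

section Finiteness

variable {k A : Type*} [Field k] (D : QuasiShuffleDatum A)

theorem length_le_wordDeg (w : List A) : w.length ≤ wordDeg D w := by
  induction w with
  | nil => simp [wordDeg]
  | cons a w ih =>
    have := D.deg_pos a
    simp only [wordDeg, List.map_cons, List.sum_cons, List.length_cons] at *
    omega

theorem finite_wordDeg_le (n : ℕ) : {w : List A | wordDeg D w ≤ n}.Finite := by
  have hA : {a : A | D.deg a ≤ n}.Finite := by
    have : {a : A | D.deg a ≤ n} = ⋃ m ∈ Set.Iic n, {a | D.deg a = m} := by ext; simp
    rw [this]
    exact (Set.finite_Iic n).biUnion fun m _ => D.locallyFinite m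
  have : Finite {a : A | D.deg a ≤ n} := hA
  refine ((List.finite_length_le {a : A | D.deg a ≤ n} n).image
    (List.map Subtype.val)).subset ?_
  intro w hw
  have hmem : ∀ a ∈ w, D.deg a ≤ n := fun a ha =>
    (List.single_le_sum (by simp) _ (List.mem_map_of_mem (f := D.deg) ha)).trans hw
  refine ⟨w.attach.map fun a => ⟨a.1, hmem a.1 a.2⟩, ?_, ?_⟩
  · rw [Set.mem_ofPred_eq, List.length_map, List.length_attach]
    exact (length_le_wordDeg D w).trans hw
  · simp [List.map_map, Function.comp_def]

theorem prepend_ne_zero {a : WithZero A} {x : NCPoly k A} {w : List A}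
    (h : prepend k a x w ≠ 0) : ∃ (c : A) (w' : List A), a = c ∧ w = c :: w' ∧ x w' ≠ 0 := by
  cases a with
  | zero => exact absurd rfl h
  | coe c =>
    have h' : Finsupp.mapDomain (List.cons c) x w ≠ 0 := h
    have hw : w ∈ Set.range (List.cons c) := by
      by_contra hw
      exact h' (Finsupp.mapDomain_of_notMem_range x w hw)
    obtain ⟨w', rfl⟩ := hw
    rw [Finsupp.mapDomain_apply (List.cons_injective)] at h'
    exact ⟨c, w', rfl, rfl, h'⟩

theorem wordDeg_of_wordMul_ne_zero (u v w : List A) (h : wordMul k D u v w ≠ 0) :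
    wordDeg D w = wordDeg D u + wordDeg D v := by
  induction u, v using wordMul.induct generalizing w with
  | case1 v =>
    simp only [wordMul, Finsupp.single_apply_ne_zero] at h
    simp [h.1, wordDeg]
  | case2 a u =>
    simp only [wordMul, Finsupp.single_apply_ne_zero] at h
    simp [h.1, wordDeg]
  | case3 a u b v ih1 ih2 ih3 =>
    simp only [wordMul, Finsupp.add_apply] at h
    have h3 : prepend k (a : WithZero A) (wordMul k D u (b :: v)) w ≠ 0 ∨
        prepend k (b : WithZero A) (wordMul k D (a :: u) v) w ≠ 0 ∨
        prepend k (D.br a b) (wordMul k D u v) w ≠ 0 := by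
      by_contra hc
      push Not at hc
      simp [hc.1, hc.2.1, hc.2.2] at h
    rcases h3 with h | h | h
    · obtain ⟨c, w', hc, rfl, hw'⟩ := prepend_ne_zero h
      obtain rfl := WithZero.coe_inj.1 hc
      have := ih1 w' hw'
      simp only [wordDeg, List.map_cons, List.sum_cons] at *
      omega
    · obtain ⟨c, w', hc, rfl, hw'⟩ := prepend_ne_zero h
      obtain rfl := WithZero.coe_inj.1 hc
      have := ih2 w' hw'
      simp only [wordDeg, List.map_cons, List.sum_cons] at *
      omega
    · obtain ⟨c, w', hc, rfl, hw'⟩ := prepend_ne_zero h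
      have := ih3 w' hw'
      rcases D.deg_br a b with h0 | ⟨c', hc', hd⟩
      · simp [h0] at hc
      · obtain rfl := WithZero.coe_inj.1 (hc'.symm.trans hc)
        simp only [wordDeg, List.map_cons, List.sum_cons] at *
        omega

theorem pairing_apply (x : NCPoly k A) (P : NCDual k A) :
    pairing k A x P = x.sum fun w c => c * P.coeff (FreeMonoid.ofList w) := by
  rw [pairing, Finsupp.lsum_apply, Finsupp.sum, Finsupp.sum, LinearMap.sum_apply]
  rfl

theorem pairing_single (w : List A) (P : NCDual k A) :
    pairing k A (Finsupp.single w 1) P = P.coeff (FreeMonoid.ofList w) := by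
  simp [pairing_apply]

theorem pairing_dualWord (x : NCPoly k A) (w : List A) :
    pairing k A x (dualWord k w) = x w := by
  classical
  rw [pairing_apply, dualWord, MonoidAlgebra.coeff_single]
  simp [Finsupp.single_apply, eq_comm]

/-- Only finitely many pairs of words `(u, v)` satisfy `(u * v, w*) ≠ 0`. -/
theorem finite_wordMul_ne_zero (w : List A) :
    {p : List A × List A | pairing k A (wordMul k D p.1 p.2) (dualWord k w) ≠ 0}.Finite := by
  refine ((finite_wordDeg_le D (wordDeg D w)).prod (finite_wordDeg_le D (wordDeg D w))).subset ?_
  rintro ⟨u, v⟩ h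
  rw [Set.mem_ofPred_eq, pairing_dualWord] at h
  have := wordDeg_of_wordMul_ne_zero D u v w h
  simp only [Set.mem_prod, Set.mem_ofPred_eq]
  omega

theorem wordDeg_of_brSeq (w : List A) (a : A) (h : brSeq D w = a) :
    wordDeg D w = D.deg a := by
  induction w using brSeq.induct generalizing a with
  | case1 => simp [brSeq] at h
  | case2 b =>
    obtain rfl := WithZero.coe_inj.1 h
    simp [wordDeg]
  | case3 b c S ih =>
    rw [brSeq] at h
    generalize hs : brSeq D (c :: S) = s at h
    cases s with
    | zero => simp [D.br_zero] at h
    | coe s =>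
      have := ih s hs
      rcases D.deg_br b s with h0 | ⟨c', hc', hd⟩
      · simp [h0] at h
      · obtain rfl := WithZero.coe_inj.1 (hc'.symm.trans h)
        simp only [wordDeg, List.map_cons, List.sum_cons] at *
        omega

/-- Only finitely many sequences `w` satisfy `[w] = a`. -/
theorem finite_brSeq_eq (a : A) : {w : List A | brSeq D w = a}.Finite :=
  (finite_wordDeg_le D (D.deg a)).subset fun w hw => (wordDeg_of_brSeq D w a hw).le

/-- The pairing identifies `NCDual k A` with the graded dual of `NCPoly k A`: the linear functionals
that vanish on all homogeneous elements of sufficiently large degree. -/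
theorem range_pairing : Function.Injective (pairing k A).flip ∧
    Set.range (pairing k A).flip = {φ : Module.Dual k (NCPoly k A) |
      ∃ N, ∀ w : List A, N < wordDeg D w → φ (Finsupp.single w 1) = 0} := by
  constructor
  · intro P Q h
    ext w
    have := LinearMap.congr_fun h (Finsupp.single w.toList 1)
    simpa [LinearMap.flip_apply, pairing_single] using this
  · ext φ
    constructor
    · rintro ⟨P, rfl⟩
      refine ⟨P.coeff.support.sup fun w => wordDeg D w.toList, fun w hw => ?_⟩
      rw [LinearMap.flip_apply, pairing_single]
      by_contra h
      have := Finset.le_sup (f := fun w : FreeMonoid A => wordDeg D w.toList)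
        (Finsupp.mem_support_iff.2 h)
      simp only [FreeMonoid.toList_ofList] at this
      omega
    · rintro ⟨N, hN⟩
      have hfin : (Function.support fun w : FreeMonoid A =>
          φ (Finsupp.single w.toList 1)).Finite := by
        refine (finite_wordDeg_le D N).subset fun w hw => ?_
        by_contra hc
        exact hw (hN _ (not_le.1 hc))
      refine ⟨MonoidAlgebra.ofCoeff (Finsupp.ofSupportFinite _ hfin), ?_⟩
      refine Finsupp.lhom_ext' fun w => LinearMap.ext_ring ?_
      simp [LinearMap.flip_apply, pairing_single, Finsupp.ofSupportFinite_coe]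

end Finiteness

/-- `δ'(w*) = ∑ (u * v, w*) u* ⊗ v*`, the sum over all pairs of words `u, v` (finitely many
terms are nonzero). -/
def comulWord (k : Type*) {A : Type*} [Field k] (D : QuasiShuffleDatum A) (w : List A) :
    NCDual k A ⊗[k] NCDual k A :=
  ∑ p ∈ (finite_wordMul_ne_zero (k := k) D w).toFinset,
    pairing k A (wordMul k D p.1 p.2) (dualWord k w) • (dualWord k p.1 ⊗ₜ[k] dualWord k p.2)

/-- The comultiplication `δ'` of the graded dual of the quasi-shuffle Hopf algebra: the linear
map with `w* ↦ δ'(w*)`. -/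
def comul (k : Type*) {A : Type*} [Field k] (D : QuasiShuffleDatum A) :
    NCDual k A →ₗ[k] NCDual k A ⊗[k] NCDual k A where
  toFun P := P.coeff.sum fun w c => c • comulWord k D w.toList
  map_add' P Q := by
    rw [MonoidAlgebra.coeff_add]
    exact Finsupp.sum_add_index' (by simp) fun w b c => add_smul b c _
  map_smul' c P := by
    rw [MonoidAlgebra.coeff_smul, Finsupp.sum_smul_index (by simp), RingHom.id_apply,
      Finsupp.smul_sum]
    simp only [mul_smul]

/-- `δ'` is the transpose of the quasi-shuffle product: `(u ⊗ v, δ'(P)) = (u * v, P)`. -/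
theorem pairing_comul {k A : Type*} [Field k] (D : QuasiShuffleDatum A) (u v : List A)
    (P : NCDual k A) :
    LinearMap.mul' k k (TensorProduct.map (pairing k A (Finsupp.single u 1))
      (pairing k A (Finsupp.single v 1)) (comul k D P)) = pairing k A (wordMul k D u v) P := by
  classical
  induction P using MonoidAlgebra.induction_linear with
  | zero => simp
  | add x y hx hy => simp [hx, hy]
  | single m c =>
    have h1 : comul k D (MonoidAlgebra.single m c) = c • comulWord k D m.toList := by
      change (Finsupp.single m c).sum (fun w c => c • comulWord k D w.toList) = _
      exact Finsupp.sum_single_index (zero_smul k _)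
    have h2 : (MonoidAlgebra.single m c : NCDual k A) = c • dualWord k m.toList := by
      simp [dualWord]
    rw [h1, h2]
    simp only [map_smul, comulWord, map_sum]
    congr 1
    rw [Finset.sum_congr rfl (g := fun p => if p = (u, v) then
      pairing k A (wordMul k D u v) (dualWord k m.toList) else 0)]
    · rw [Finset.sum_ite_eq']
      split_ifs with h
      · rfl
      · symm
        simpa using h
    · rintro ⟨p, q⟩ hp
      simp only [TensorProduct.map_tmul, pairing_dualWord, LinearMap.mul'_apply]
      by_cases hu : u = p
      · by_cases hv : v = q
        · subst hu hv
          simp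
        · simp [Ne.symm hv]
      · simp [Ne.symm hu]

/-- An element `P` is primitive for `δ'` if `δ'(P) = P ⊗ 1 + 1 ⊗ P`. -/
def IsPrimitive {k A : Type*} [Field k] (D : QuasiShuffleDatum A) (P : NCDual k A) : Prop :=
  comul k D P = P ⊗ₜ[k] 1 + 1 ⊗ₜ[k] P

/-- `log*(a*) = ∑_{n ≥ 1} (-1)^(n-1)/n ∑_{[a₁,…,aₙ] = a} (a₁⋯aₙ)*` (finitely many terms;
the empty sequence does not occur since its bracket is `0`). -/
def logStarLetter (k : Type*) {A : Type*} [Field k] (D : QuasiShuffleDatum A) (a : A) :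
    NCDual k A :=
  ∑ w ∈ (finite_brSeq_eq D a).toFinset,
    ((-1 : k) ^ (w.length - 1) / (w.length : k)) • dualWord k w

/-- `log*` is the endomorphism of the concatenation algebra with the given values on letters. -/
def logStar (k : Type*) {A : Type*} [Field k] (D : QuasiShuffleDatum A) :
    NCDual k A →ₐ[k] NCDual k A :=
  MonoidAlgebra.lift k (NCDual k A) (FreeMonoid A) (FreeMonoid.lift (logStarLetter k D))

/-- The Lie polynomials: the smallest subspace of the graded dual containing all `a*`, `a ∈ A`, and
closed under the Lie bracket `P Q - Q P`. -/
def liePolynomials (k A : Type*) [Field k] : Submodule k (NCDual k A) :=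
  sInf {V | (∀ a : A, dualWord k [a] ∈ V) ∧ ∀ P ∈ V, ∀ Q ∈ V, P * Q - Q * P ∈ V}

end QuasiShuffle

end

/-!
The proof reduces to Friedrichs' criterion for the ordinary coproduct of the free algebra, for which
the letters are primitive (`freeComul`).

Transposing the recursion for `*` shows that `δ'` is multiplicative for concatenation
(`comul_eq_liftLetters`). Moreover the elements `log*(a*)` are primitive for `δ'`
(`isPrimitive_logStarLetter`): all words in `u * v` have the same bracket, and the number `N(n)` of
those of length `n`, as long as that bracket is nonzero, satisfies
`∑ N(n) (X choose n) = (X choose |u|) (X choose |v|)` (`chooseWeight_wordMul`, by Pascal's rule). The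
linear coefficient of `X choose n` is `(-1)^(n-1)/n`, the coefficient of a word of length `n` in
`log*(a*)`, whereas the right side has no linear term when `u` and `v` are nonempty. Hence
`δ' ∘ log* = (log* ⊗ log*) ∘ freeComul` (`comul_logStar`).

Since `log*(a*)` is `a*` plus longer words in letters of smaller degree, `log*` is injective
(compare the terms of lowest length) and surjective (induct on the degree of the letters). So the
primitive elements for `δ'` are the images of the primitive elements for `freeComul`. These are the
Lie polynomials: the convolution of the antipode with the length derivation sends every word to a
left-normed bracket (`dynkin_mem_liePolynomials`), sends a primitive element to its image
under the length derivation, and that derivation is invertible on Lie polynomials.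
-/

noncomputable section

namespace QuasiShuffle

variable {k A : Type*} [Field k]

/-! ### Words as a basis -/

theorem dualWord_nil : dualWord k ([] : List A) = 1 := rfl

theorem dualWord_append (u v : List A) :
    dualWord k (u ++ v) = dualWord k u * dualWord k v := by
  simp [dualWord, MonoidAlgebra.single_mul_single]

theorem dualWord_cons (a : A) (w : List A) :
    dualWord k (a :: w) = dualWord k [a] * dualWord k w :=
  dualWord_append [a] w

theorem coeff_dualWord [DecidableEq A] (u w : List A) :
    (dualWord k u).coeff (FreeMonoid.ofList w) = if u = w then 1 else 0 := by
  rw [← pairing_single, pairing_dualWord, Finsupp.single_apply]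
  simp only [eq_comm]

/-- The basis `{w*}` of the graded dual, indexed by words. -/
def wordBasis (k A : Type*) [Field k] : Module.Basis (List A) k (NCDual k A) :=
  (MonoidAlgebra.basis (FreeMonoid A) k).reindex FreeMonoid.ofList.symm

@[simp]
theorem wordBasis_apply (w : List A) : wordBasis k A w = dualWord k w := by
  simp [wordBasis, dualWord]

@[simp]
theorem wordBasis_repr_apply (P : NCDual k A) (w : List A) :
    (wordBasis k A).repr P w = P.coeff (FreeMonoid.ofList w) := by
  simp [wordBasis, MonoidAlgebra.basis]

theorem span_range_dualWord : Submodule.span k (Set.range (dualWord k (A := A))) = ⊤ := by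
  rw [← (wordBasis k A).span_eq]
  congr 2
  funext w
  exact (wordBasis_apply w).symm

theorem linearMap_ext {M : Type*} [AddCommMonoid M] [Module k M] {f g : NCDual k A →ₗ[k] M}
    (h : ∀ w, f (dualWord k w) = g (dualWord k w)) : f = g :=
  (wordBasis k A).ext fun w => by simpa using h w

theorem algHom_ext_letters {B : Type*} [Semiring B] [Algebra k B] {f g : NCDual k A →ₐ[k] B}
    (h : ∀ a, f (dualWord k [a]) = g (dualWord k [a])) : f = g := by
  have : f.toLinearMap = g.toLinearMap := linearMap_ext fun w => by
    simp only [AlgHom.toLinearMap_apply]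
    induction w with
    | nil => simp [dualWord_nil]
    | cons a w ih => rw [dualWord_cons, map_mul, map_mul, h, ih]
  exact AlgHom.toLinearMap_injective this

/-- The algebra homomorphism out of the concatenation algebra with prescribed values on
the letters. -/
def liftLetters (k : Type*) {A B : Type*} [Field k] [Semiring B] [Algebra k B] (f : A → B) :
    NCDual k A →ₐ[k] B :=
  MonoidAlgebra.lift k B (FreeMonoid A) (FreeMonoid.lift f)

@[simp]
theorem liftLetters_letter {B : Type*} [Semiring B] [Algebra k B] (f : A → B) (a : A) :
    liftLetters k f (dualWord k [a]) = f a := by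
  simp [liftLetters, dualWord]

theorem logStar_letter (D : QuasiShuffleDatum A) (a : A) :
    logStar k D (dualWord k [a]) = logStarLetter k D a :=
  liftLetters_letter _ a

/-! ### Coefficients of tensors -/

/-- The coefficient of `u* ⊗ v*` in an element of the tensor square. -/
def tensorCoeff (k : Type*) {A : Type*} [Field k] (u v : List A) :
    NCDual k A ⊗[k] NCDual k A →ₗ[k] k :=
  LinearMap.mul' k k ∘ₗ TensorProduct.map (pairing k A (Finsupp.single u 1))
    (pairing k A (Finsupp.single v 1))

@[simp]
theorem tensorCoeff_tmul (u v : List A) (P Q : NCDual k A) :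
    tensorCoeff k u v (P ⊗ₜ Q) =
      P.coeff (FreeMonoid.ofList u) * Q.coeff (FreeMonoid.ofList v) := by
  simp [tensorCoeff, pairing_single]

theorem tensorCoeff_comul (D : QuasiShuffleDatum A) (u v : List A) (P : NCDual k A) :
    tensorCoeff k u v (comul k D P) = pairing k A (wordMul k D u v) P :=
  pairing_comul D u v P

theorem tensor_ext {X Y : NCDual k A ⊗[k] NCDual k A}
    (h : ∀ u v, tensorCoeff k u v X = tensorCoeff k u v Y) : X = Y := by
  have key : ∀ u v, tensorCoeff k u v =
      ((wordBasis k A).tensorProduct (wordBasis k A)).coord (u, v) := fun u v => by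
    refine TensorProduct.ext' fun P Q => ?_
    simp [Module.Basis.tensorProduct_repr_tmul_apply, mul_comm]
  refine ((wordBasis k A).tensorProduct (wordBasis k A)).repr.injective (Finsupp.ext ?_)
  rintro ⟨u, v⟩
  simpa [key] using h u v

theorem coeff_letter_mul_nil (c : A) (P : NCDual k A) :
    (dualWord k [c] * P).coeff (FreeMonoid.ofList []) = 0 := by
  refine MonoidAlgebra.coeff_single_mul_of_forall_mul_ne _ _ fun d hd => ?_
  exact List.cons_ne_nil c d.toList hd

theorem coeff_letter_mul_cons [DecidableEq A] (c a : A) (u : List A) (P : NCDual k A) :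
    (dualWord k [c] * P).coeff (FreeMonoid.ofList (a :: u)) =
      if a = c then P.coeff (FreeMonoid.ofList u) else 0 := by
  split_ifs with h
  · subst h
    rw [dualWord, MonoidAlgebra.coeff_single_mul_eq_mul_coeff (FreeMonoid.ofList u), one_mul]
    exact fun d _ => ⟨fun hd => (List.cons_inj_right a).1 hd, fun hd => hd ▸ rfl⟩
  · refine MonoidAlgebra.coeff_single_mul_of_forall_mul_ne _ _ fun d hd => h ?_
    exact (List.cons.inj (show c :: d.toList = a :: u from hd)).1.symm

theorem tensorCoeff_left_mul_nil (c : A) (v : List A) (X : NCDual k A ⊗[k] NCDual k A) :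
    tensorCoeff k [] v (dualWord k [c] ⊗ₜ 1 * X) = 0 := by
  induction X with
  | zero => simp
  | add x y hx hy => simp [mul_add, hx, hy]
  | tmul x y => simp [coeff_letter_mul_nil, -FreeMonoid.ofList_nil]

theorem tensorCoeff_left_mul_cons [DecidableEq A] (c a : A) (u v : List A)
    (X : NCDual k A ⊗[k] NCDual k A) :
    tensorCoeff k (a :: u) v (dualWord k [c] ⊗ₜ 1 * X) =
      if a = c then tensorCoeff k u v X else 0 := by
  induction X with
  | zero => simp
  | add x y hx hy => rw [mul_add, map_add, hx, hy]; split_ifs <;> simp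
  | tmul x y =>
    simp only [Algebra.TensorProduct.tmul_mul_tmul, tensorCoeff_tmul, coeff_letter_mul_cons]
    split_ifs <;> simp

theorem tensorCoeff_right_mul_nil (c : A) (u : List A) (X : NCDual k A ⊗[k] NCDual k A) :
    tensorCoeff k u [] (1 ⊗ₜ dualWord k [c] * X) = 0 := by
  induction X with
  | zero => simp
  | add x y hx hy => simp [mul_add, hx, hy]
  | tmul x y => simp [coeff_letter_mul_nil, -FreeMonoid.ofList_nil]

theorem tensorCoeff_right_mul_cons [DecidableEq A] (c b : A) (u v : List A)
    (X : NCDual k A ⊗[k] NCDual k A) :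
    tensorCoeff k u (b :: v) (1 ⊗ₜ dualWord k [c] * X) =
      if b = c then tensorCoeff k u v X else 0 := by
  induction X with
  | zero => simp
  | add x y hx hy => rw [mul_add, map_add, hx, hy]; split_ifs <;> simp
  | tmul x y =>
    simp only [Algebra.TensorProduct.tmul_mul_tmul, tensorCoeff_tmul, coeff_letter_mul_cons]
    split_ifs <;> simp

/-! ### The comultiplication is an algebra homomorphism -/

theorem finite_br_eq (D : QuasiShuffleDatum A) (c : A) :
    {p : A × A | D.br p.1 p.2 = c}.Finite := by
  refine ((finite_brSeq_eq D c).preimage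
    (f := fun p : A × A => [p.1, p.2]) fun p _ q _ h => ?_).subset fun p hp => ?_
  · simp only [List.cons.injEq, and_true] at h
    exact Prod.ext h.1 h.2
  · simpa [brSeq] using hp

/-- The value of `δ'` on a letter: `c ⊗ 1 + 1 ⊗ c + ∑_{[a,b] = c} a ⊗ b`. -/
def comulLetter (k : Type*) {A : Type*} [Field k] (D : QuasiShuffleDatum A) (c : A) :
    NCDual k A ⊗[k] NCDual k A :=
  dualWord k [c] ⊗ₜ 1 + 1 ⊗ₜ dualWord k [c] +
    ∑ p ∈ (finite_br_eq D c).toFinset, dualWord k [p.1] ⊗ₜ dualWord k [p.2]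

theorem letter_tmul_letter (a b : A) : dualWord k [a] ⊗ₜ[k] dualWord k [b] =
    (dualWord k [a] ⊗ₜ[k] 1) * (1 ⊗ₜ[k] dualWord k [b]) := by simp

theorem prepend_apply_cons [DecidableEq A] (x : WithZero A) (y : NCPoly k A) (c : A)
    (w : List A) : prepend k x y (c :: w) = if x = c then y w else 0 := by
  cases x with
  | zero => rw [if_neg (WithZero.coe_ne_zero (a := c)).symm]; rfl
  | coe a =>
    change Finsupp.mapDomain (List.cons a) y (c :: w) = _
    by_cases h : a = c
    · subst h
      simp [Finsupp.mapDomain_apply List.cons_injective]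
    · rw [if_neg (by simpa using h), Finsupp.mapDomain_of_notMem_range]
      rintro ⟨w', hw⟩
      exact h (List.cons.inj hw).1

theorem tensorCoeff_comulLetter_mul (D : QuasiShuffleDatum A) (c : A) (w u v : List A)
    (X : NCDual k A ⊗[k] NCDual k A)
    (hX : ∀ u v, tensorCoeff k u v X = wordMul k D u v w) :
    tensorCoeff k u v (comulLetter k D c * X) = wordMul k D u v (c :: w) := by
  classical
  simp only [comulLetter, letter_tmul_letter, add_mul, Finset.sum_mul, map_add, map_sum, mul_assoc]
  cases u with
  | nil =>
    simp only [tensorCoeff_left_mul_nil, Finset.sum_const_zero]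
    cases v with
    | nil => simp [tensorCoeff_right_mul_nil, wordMul]
    | cons b v =>
      simp [tensorCoeff_right_mul_cons, hX, wordMul, Finsupp.single_apply, ite_and]
  | cons a u =>
    cases v with
    | nil =>
      simp [tensorCoeff_right_mul_nil, tensorCoeff_left_mul_cons, hX]
      cases u <;> simp [wordMul, Finsupp.single_apply, ite_and]
    | cons b v =>
      simp only [tensorCoeff_right_mul_cons, tensorCoeff_left_mul_cons, hX, wordMul,
        Finsupp.add_apply, prepend_apply_cons, WithZero.coe_inj]
      congr 1
      simp only [← ite_and]
      rw [Finset.sum_congr rfl (g := fun p => if p = (a, b) then wordMul k D u v w else 0)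
        fun p _ => if_congr (by rw [Prod.ext_iff, eq_comm, @eq_comm _ b]) rfl rfl]
      simp

/-- `δ'` is multiplicative for concatenation. The recursion for `*` in the first letter
is the transpose of `δ'(c w) = δ'(c) δ'(w)`. -/
theorem comul_eq_liftLetters (D : QuasiShuffleDatum A) :
    comul k D = (liftLetters k (comulLetter k D)).toLinearMap := by
  refine linearMap_ext fun w => tensor_ext fun u v => ?_
  rw [tensorCoeff_comul, pairing_dualWord]
  simp only [AlgHom.toLinearMap_apply]
  induction w generalizing u v with
  | nil =>
    rw [dualWord_nil, map_one]
    classical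
    rw [Algebra.TensorProduct.one_def, tensorCoeff_tmul, ← dualWord_nil, coeff_dualWord,
      coeff_dualWord]
    cases u with
    | nil => simp [wordMul, Finsupp.single_apply, eq_comm]
    | cons a u =>
      cases v with
      | nil => simp [wordMul]
      | cons b v =>
        have h : ∀ (x : WithZero A) (y : NCPoly k A), prepend k x y [] = 0 := fun x y => by
          by_contra h
          obtain ⟨c, w', _, h', _⟩ := prepend_ne_zero h
          exact List.cons_ne_nil _ _ h'.symm
        simp [wordMul, h]
  | cons c w ih =>
    rw [dualWord_cons, map_mul, liftLetters_letter]
    exact (tensorCoeff_comulLetter_mul D c w u v _ fun u v => (ih u v).symm).symm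

theorem comul_mul (D : QuasiShuffleDatum A) (P Q : NCDual k A) :
    comul k D (P * Q) = comul k D P * comul k D Q := by
  simp [comul_eq_liftLetters]

/-- The primitive elements are closed under commutators. -/
theorem IsPrimitive.commutator {D : QuasiShuffleDatum A} {P Q : NCDual k A}
    (hP : IsPrimitive D P) (hQ : IsPrimitive D Q) : IsPrimitive D (P * Q - Q * P) := by
  unfold IsPrimitive at *
  rw [map_sub, comul_mul, comul_mul, hP, hQ]
  simp only [add_mul, mul_add, Algebra.TensorProduct.tmul_mul_tmul, one_mul, mul_one,
    TensorProduct.sub_tmul, TensorProduct.tmul_sub]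
  abel

/-! ### The logarithms of letters are primitive -/

/-- The action of `Ā` on `Ā` with a unit `none` adjoined: `x · 1 = x` and `x · t = [x, t]`. -/
def brUnit (D : QuasiShuffleDatum A) (x : WithZero A) : Option (WithZero A) → Option (WithZero A)
  | none => some x
  | some t => some (D.br x t)

/-- The bracket `[a₁, …, aₙ, s]` of a word and an element `s` of `Ā` with a unit adjoined. -/
def brFold (D : QuasiShuffleDatum A) (w : List A) (s : Option (WithZero A)) :
    Option (WithZero A) :=
  w.foldr (fun a t => brUnit D a t) s

section

variable (D : QuasiShuffleDatum A)

theorem brUnit_comm (x y : WithZero A) (s : Option (WithZero A)) :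
    brUnit D x (brUnit D y s) = brUnit D y (brUnit D x s) := by
  cases s with
  | none => simp [brUnit, D.br_comm]
  | some t => simp only [brUnit]; rw [← D.br_assoc, ← D.br_assoc, D.br_comm x]

theorem brUnit_br (x y : WithZero A) (s : Option (WithZero A)) :
    brUnit D (D.br x y) s = brUnit D x (brUnit D y s) := by
  cases s with
  | none => rfl
  | some t => simp [brUnit, D.br_assoc]

theorem brUnit_zero (s : Option (WithZero A)) : brUnit D 0 s = some 0 := by
  cases s with
  | none => rfl
  | some t => simp [brUnit, D.br_comm 0, D.br_zero]

theorem brFold_zero (w : List A) : brFold D w (some 0) = some 0 := by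
  induction w with
  | nil => rfl
  | cons a w ih =>
    change brUnit D a (brFold D w (some 0)) = _
    rw [ih, brUnit, D.br_zero]

theorem brFold_cons (a : A) (w : List A) (s : Option (WithZero A)) :
    brFold D (a :: w) s = brUnit D a (brFold D w s) := rfl

theorem brFold_brUnit (w : List A) (x : WithZero A) (s : Option (WithZero A)) :
    brFold D w (brUnit D x s) = brUnit D x (brFold D w s) := by
  induction w with
  | nil => rfl
  | cons a w ih => rw [brFold_cons, ih, brUnit_comm, brFold_cons]

theorem brFold_none (a : A) (w : List A) :
    brFold D (a :: w) none = some (brSeq D (a :: w)) := by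
  induction w generalizing a with
  | nil => rfl
  | cons b w ih => rw [brFold_cons, ih, brUnit, brSeq]

variable (h : Option (WithZero A) → k)

/-- The linear functional `w ↦ h([w, s]) * (m choose |w|)` on noncommutative polynomials. -/
def chooseWeight (s : Option (WithZero A)) (m : ℕ) : NCPoly k A →ₗ[k] k :=
  Finsupp.linearCombination k fun w => h (brFold D w s) * (m.choose w.length : k)

theorem chooseWeight_single (s : Option (WithZero A)) (m : ℕ) (w : List A) :
    chooseWeight D h s m (Finsupp.single w 1) = h (brFold D w s) * (m.choose w.length : k) := by
  simp [chooseWeight]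

theorem prepend_single (c : A) (w : List A) (r : k) :
    prepend k (c : WithZero A) (Finsupp.single w r) = Finsupp.single (c :: w) r :=
  Finsupp.mapDomain_single

theorem chooseWeight_prepend_zero (s : Option (WithZero A)) (x : WithZero A) (y : NCPoly k A) :
    chooseWeight D h s 0 (prepend k x y) = 0 := by
  cases x with
  | zero => exact map_zero _
  | coe c =>
    induction y using Finsupp.induction_linear with
    | zero => simp
    | add y z hy hz => simp [hy, hz]
    | single w r => simp [prepend_single, chooseWeight]

theorem chooseWeight_some_zero (h0 : h (some 0) = 0) (m : ℕ) (y : NCPoly k A) :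
    chooseWeight D h (some 0) m y = 0 := by
  simp [chooseWeight, Finsupp.linearCombination_apply, brFold_zero, h0]

/-- Pascal's rule for `chooseWeight`. -/
theorem chooseWeight_prepend_succ (h0 : h (some 0) = 0) (s : Option (WithZero A)) (m : ℕ)
    (x : WithZero A) (y : NCPoly k A) :
    chooseWeight D h s (m + 1) (prepend k x y) =
      chooseWeight D h (brUnit D x s) m y + chooseWeight D h s m (prepend k x y) := by
  cases x with
  | zero =>
    change chooseWeight D h s (m + 1) 0 = chooseWeight D h (brUnit D 0 s) m y +
      chooseWeight D h s m 0
    rw [brUnit_zero, chooseWeight_some_zero D h h0]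
    simp
  | coe c =>
    induction y using Finsupp.induction_linear with
    | zero => simp
    | add y z hy hz => simp only [map_add, hy, hz]; abel
    | single w r =>
      simp only [prepend_single, chooseWeight, Finsupp.linearCombination_single, smul_eq_mul,
        List.length_cons, Nat.choose_succ_succ, Nat.cast_add, brFold_brUnit, brFold_cons]
      ring

/-- The identity `∑ₙ N(n) (m choose n) = (m choose |u|) (m choose |v|)`, with `N(n)` the number of
words of length `n` in `u * v`, refined by the observation that every word of `u * v` has the
bracket `[u, v]`. -/
theorem chooseWeight_wordMul (h0 : h (some 0) = 0) (m : ℕ) (u v : List A)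
    (s : Option (WithZero A)) :
    chooseWeight D h s m (wordMul k D u v) =
      h (brFold D u (brFold D v s)) * ((m.choose u.length : k) * (m.choose v.length : k)) := by
  induction m generalizing u v s with
  | zero =>
    match u, v with
    | [], v => simp [wordMul, chooseWeight_single, brFold]
    | a :: u, [] => simp [wordMul, chooseWeight_single, brFold]
    | a :: u, b :: v => simp [wordMul, chooseWeight_prepend_zero]
  | succ m ih =>
    match u, v with
    | [], v => simp [wordMul, chooseWeight_single, brFold]
    | a :: u, [] => simp [wordMul, chooseWeight_single, brFold]
    | a :: u, b :: v =>
      have hm := ih (a :: u) (b :: v) s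
      simp only [wordMul, map_add] at hm
      simp only [wordMul, map_add, chooseWeight_prepend_succ D h h0, ih, List.length_cons,
        Nat.choose_succ_succ, Nat.cast_add]
      simp only [List.length_cons, brFold_cons, brFold_brUnit, brUnit_br] at hm ⊢
      rw [brUnit_comm D b a] at *
      linear_combination hm

end

/-- The polynomial `X (X - 1) ⋯ (X - n + 1) / n!`. -/
def choosePoly (k : Type*) [Field k] (n : ℕ) : Polynomial k :=
  Polynomial.C ((n.factorial : k)⁻¹) * descPochhammer k n

theorem eval_choosePoly [CharZero k] (n m : ℕ) :
    (choosePoly k n).eval (m : k) = (m.choose n : k) := by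
  rw [Nat.cast_choose_eq_descPochhammer_div, choosePoly, Polynomial.eval_mul, Polynomial.eval_C,
    div_eq_inv_mul]

theorem coeff_zero_choosePoly_succ (n : ℕ) : (choosePoly k (n + 1)).coeff 0 = 0 := by
  simp [choosePoly, Polynomial.coeff_zero_eq_eval_zero]

theorem coeff_one_choosePoly_succ [CharZero k] (n : ℕ) :
    (choosePoly k (n + 1)).coeff 1 = (-1) ^ n / ((n + 1 : ℕ) : k) := by
  have h : (descPochhammer k (n + 1)).coeff 1 = (-1) ^ n * (n.factorial : k) := by
    induction n with
    | zero => simp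
    | succ n ih =>
      rw [descPochhammer_succ_right, mul_sub, Polynomial.coeff_sub, Polynomial.coeff_mul_X,
        ← Polynomial.C_eq_natCast, Polynomial.coeff_mul_C, ih, Polynomial.coeff_zero_eq_eval_zero,
        descPochhammer_ne_zero_eval_zero k n.succ_ne_zero, Nat.factorial_succ]
      push_cast
      ring
  rw [choosePoly, Polynomial.coeff_C_mul, h, Nat.factorial_succ]
  have h1 : (n.factorial : k) ≠ 0 := by exact_mod_cast n.factorial_ne_zero
  have h2 : ((n + 1 : ℕ) : k) ≠ 0 := by exact_mod_cast n.succ_ne_zero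
  push_cast at *
  field_simp

theorem coeff_logStarLetter [CharZero k] [DecidableEq A] (D : QuasiShuffleDatum A) (a : A)
    (w : List A) : (logStarLetter k D a).coeff (FreeMonoid.ofList w) =
      if brFold D w none = some (a : WithZero A) then (choosePoly k w.length).coeff 1 else 0 := by
  have h1 : (logStarLetter k D a).coeff (FreeMonoid.ofList w) =
      if brSeq D w = a then (-1 : k) ^ (w.length - 1) / (w.length : k) else 0 := by
    rw [← wordBasis_repr_apply, logStarLetter, map_sum, Finsupp.finsetSum_apply]
    simp [coeff_dualWord]
  rw [h1]
  cases w with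
  | nil => simp [brSeq, brFold]
  | cons c w => simp [brFold_none, coeff_one_choosePoly_succ]

/-- `log*(a*)` is orthogonal to all products of nonempty words: its coefficients are linear
coefficients of binomial polynomials, and a product of two binomial polynomials of positive degree
has no linear term. -/
theorem pairing_wordMul_logStarLetter [CharZero k] (D : QuasiShuffleDatum A) (a b c : A)
    (u v : List A) : pairing k A (wordMul k D (b :: u) (c :: v)) (logStarLetter k D a) = 0 := by
  classical
  set x := wordMul k D (b :: u) (c :: v)
  let h : Option (WithZero A) → k := fun s => if s = some (a : WithZero A) then 1 else 0
  have h0 : h (some 0) = 0 := by simp [h]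
  -- `chooseWeight_wordMul` holds for all natural `m`, hence as an identity of polynomials in `m`.
  have key : x.sum (fun w r => Polynomial.C (r * h (brFold D w none)) * choosePoly k w.length) =
      Polynomial.C (h (brFold D (b :: u) (brFold D (c :: v) none))) *
        (choosePoly k (u.length + 1) * choosePoly k (v.length + 1)) := by
    refine Polynomial.eq_of_infinite_eval_eq _ _ (Set.Infinite.mono ?_
      (Set.infinite_range_of_injective (Nat.cast_injective (R := k))))
    rintro _ ⟨m, rfl⟩
    have := chooseWeight_wordMul D h h0 m (b :: u) (c :: v) none
    simp only [Set.mem_ofPred_eq, Finsupp.sum, Polynomial.eval_finsetSum, Polynomial.eval_mul,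
      Polynomial.eval_C, eval_choosePoly]
    rw [← List.length_cons (a := b), ← List.length_cons (a := c), ← this]
    simp [chooseWeight, Finsupp.linearCombination_apply, Finsupp.sum, x, mul_assoc]
  have := congrArg (fun p => p.coeff 1) key
  simp only [Finsupp.sum, Polynomial.finsetSum_coeff, Polynomial.coeff_C_mul] at this
  rw [pairing_apply, Finsupp.sum]
  simp only [coeff_logStarLetter]
  calc _ = _ := Finset.sum_congr rfl fun w _ => by simp only [h]; split_ifs <;> simp
    _ = _ := this
    _ = 0 := by
      simp [Polynomial.coeff_mul, Finset.Nat.antidiagonal_succ, coeff_zero_choosePoly_succ]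

theorem isPrimitive_logStarLetter [CharZero k] (D : QuasiShuffleDatum A) (a : A) :
    IsPrimitive D (logStarLetter k D a) := by
  classical
  have hnil : (logStarLetter k D a).coeff (FreeMonoid.ofList []) = 0 := by
    rw [coeff_logStarLetter]; simp [brFold]
  refine tensor_ext fun u v => ?_
  rw [tensorCoeff_comul, map_add, tensorCoeff_tmul, tensorCoeff_tmul, ← dualWord_nil,
    coeff_dualWord, coeff_dualWord]
  match u, v with
  | [], v => simp only [wordMul, pairing_single, hnil]; simp
  | b :: u, [] => simp [wordMul, pairing_single]
  | b :: u, c :: v => simp [pairing_wordMul_logStarLetter]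

/-! ### The logarithm is bijective -/

/-- The span of the words of length at least `n`. -/
def lengthGE (k A : Type*) [Field k] (n : ℕ) : Submodule k (NCDual k A) :=
  Submodule.span k (dualWord k '' {w : List A | n ≤ w.length})

theorem dualWord_mem_lengthGE {n : ℕ} {w : List A} (h : n ≤ w.length) :
    dualWord k w ∈ lengthGE k A n :=
  Submodule.subset_span ⟨w, h, rfl⟩

theorem mul_mem_lengthGE {m n : ℕ} {P Q : NCDual k A} (hP : P ∈ lengthGE k A m)
    (hQ : Q ∈ lengthGE k A n) : P * Q ∈ lengthGE k A (m + n) := by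
  have h := Submodule.mul_mem_mul hP hQ
  rw [lengthGE, lengthGE, Submodule.span_mul_span] at h
  refine Submodule.span_le.2 ?_ h
  rintro _ ⟨_, ⟨u, hu, rfl⟩, _, ⟨v, hv, rfl⟩, rfl⟩
  simp only [← dualWord_append]
  refine dualWord_mem_lengthGE ?_
  rw [List.length_append]
  exact add_le_add hu hv

theorem coeff_eq_zero_of_mem_lengthGE {n : ℕ} {P : NCDual k A} (hP : P ∈ lengthGE k A n)
    {w : List A} (hw : w.length < n) : P.coeff (FreeMonoid.ofList w) = 0 := by
  classical
  rw [← wordBasis_repr_apply]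
  induction hP using Submodule.span_induction with
  | mem x hx =>
    obtain ⟨u, hu, rfl⟩ := hx
    rw [wordBasis_repr_apply, coeff_dualWord, if_neg]
    rintro rfl
    exact absurd hw (not_lt.2 hu)
  | zero => simp
  | add x y _ _ hx hy => rw [map_add, Finsupp.add_apply, hx, hy, add_zero]
  | smul c x _ hx => rw [map_smul, Finsupp.smul_apply, hx, smul_zero]

theorem brSeq_singleton_or (D : QuasiShuffleDatum A) {a : A} {w : List A} (h : brSeq D w = a) :
    w = [a] ∨ 2 ≤ w.length := by
  match w with
  | [] => exact absurd h.symm WithZero.coe_ne_zero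
  | [b] => exact Or.inl (by rw [WithZero.coe_inj.1 h])
  | b :: c :: w => exact Or.inr (by simp)

/-- `log*(a*)` differs from `a*` by a combination of words of length at least `2` with
bracket `a`. -/
theorem logStarLetter_sub_mem (D : QuasiShuffleDatum A) (a : A) (V : Submodule k (NCDual k A))
    (hV : ∀ w, brSeq D w = a → 2 ≤ w.length → dualWord k w ∈ V) :
    logStarLetter k D a - dualWord k [a] ∈ V := by
  classical
  have ha : [a] ∈ (finite_brSeq_eq D a).toFinset := by simp [brSeq]
  rw [logStarLetter, ← Finset.add_sum_erase _ _ ha]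
  have : ((-1 : k) ^ ([a].length - 1) / ([a].length : k)) • dualWord k [a] = dualWord k [a] := by
    simp
  rw [this, add_sub_cancel_left]
  refine V.sum_mem fun w hw => V.smul_mem _ ?_
  simp only [Finset.mem_erase, Set.Finite.mem_toFinset, Set.mem_ofPred_eq] at hw
  exact hV w hw.2 ((brSeq_singleton_or D hw.2).resolve_left hw.1)

theorem logStar_dualWord_sub_mem (D : QuasiShuffleDatum A) (w : List A) :
    logStar k D (dualWord k w) - dualWord k w ∈ lengthGE k A (w.length + 1) := by
  induction w with
  | nil => simp [dualWord_nil]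
  | cons a w ih =>
    have h2 := logStarLetter_sub_mem (k := k) D a (lengthGE k A 2)
      fun w _ hw => dualWord_mem_lengthGE hw
    have h1 : logStarLetter k D a ∈ lengthGE k A 1 := by
      rw [← sub_add_cancel (logStarLetter k D a) (dualWord k [a])]
      refine add_mem (Submodule.span_mono (Set.image_mono fun w hw => ?_) h2)
        (dualWord_mem_lengthGE (by simp))
      exact le_trans one_le_two (show 2 ≤ w.length from hw)
    have e : logStar k D (dualWord k (a :: w)) - dualWord k (a :: w) =
        logStarLetter k D a * (logStar k D (dualWord k w) - dualWord k w) +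
          (logStarLetter k D a - dualWord k [a]) * dualWord k w := by
      rw [dualWord_cons, map_mul, logStar_letter]
      noncomm_ring
    rw [e, List.length_cons]
    refine add_mem ?_ ?_
    · convert mul_mem_lengthGE h1 ih using 2
      omega
    · convert mul_mem_lengthGE h2 (dualWord_mem_lengthGE (k := k) (le_refl w.length)) using 2
      omega

/-- `log*` preserves the terms of lowest length. -/
theorem logStar_sub_mem (D : QuasiShuffleDatum A) {n : ℕ} {P : NCDual k A}
    (hP : P ∈ lengthGE k A n) : logStar k D P - P ∈ lengthGE k A (n + 1) := by
  induction hP using Submodule.span_induction with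
  | mem x hx =>
    obtain ⟨w, hw, rfl⟩ := hx
    refine Submodule.span_mono (Set.image_mono fun v hv => ?_) (logStar_dualWord_sub_mem D w)
    exact le_trans (Nat.succ_le_succ hw) hv
  | zero => simp
  | add x y _ _ hx hy =>
    rw [map_add, add_sub_add_comm]
    exact add_mem hx hy
  | smul c x _ hx =>
    rw [map_smul, ← smul_sub]
    exact Submodule.smul_mem _ c hx

theorem logStar_injective (D : QuasiShuffleDatum A) : Function.Injective (logStar k D) := by
  refine (injective_iff_map_eq_zero _).2 fun P hP => ?_
  have h : ∀ n, P ∈ lengthGE k A n := fun n => by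
    induction n with
    | zero =>
      have : lengthGE k A 0 = ⊤ := by simp [lengthGE, span_range_dualWord]
      simp [this]
    | succ n ih =>
      have := logStar_sub_mem D ih
      rwa [hP, zero_sub, neg_mem_iff] at this
  ext w
  exact coeff_eq_zero_of_mem_lengthGE (h (w.toList.length + 1)) (Nat.lt_succ_self _)

theorem dualWord_mem_of_letters (S : Subalgebra k (NCDual k A)) (w : List A)
    (h : ∀ a ∈ w, dualWord k [a] ∈ S) : dualWord k w ∈ S := by
  induction w with
  | nil => exact S.one_mem
  | cons a w ih =>
    rw [dualWord_cons]
    exact S.mul_mem (h a (by simp)) (ih fun b hb => h b (by simp [hb]))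

theorem deg_lt_wordDeg (D : QuasiShuffleDatum A) {w : List A} (hw : 2 ≤ w.length) {a : A}
    (ha : a ∈ w) : D.deg a < wordDeg D w := by
  obtain ⟨u, v, rfl⟩ := List.append_of_mem ha
  have hu := length_le_wordDeg D u
  have hv := length_le_wordDeg D v
  simp only [wordDeg, List.map_append, List.map_cons, List.sum_append, List.sum_cons,
    List.length_append, List.length_cons] at *
  omega

/-- Every letter is in the range, by induction on the degree: the letters of the other
words in `log*(a*)` have smaller degree than `a`. -/
theorem logStar_surjective (D : QuasiShuffleDatum A) : Function.Surjective (logStar k D) := by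
  have hl : ∀ n, ∀ a : A, D.deg a = n → dualWord k [a] ∈ (logStar k D).range := fun n => by
    induction n using Nat.strong_induction_on with
    | _ n ih =>
      rintro a rfl
      have h := logStarLetter_sub_mem (k := k) D a (Subalgebra.toSubmodule (logStar k D).range)
        fun w hw h2 => dualWord_mem_of_letters _ w fun b hb =>
          ih _ (wordDeg_of_brSeq D w a hw ▸ deg_lt_wordDeg D h2 hb) b rfl
      have h' : logStarLetter k D a ∈ (logStar k D).range := ⟨_, logStar_letter D a⟩
      have := sub_mem h' h
      rwa [sub_sub_cancel] at this
  intro P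
  have hP : P ∈ Submodule.span k (Set.range (dualWord k (A := A))) := by
    rw [span_range_dualWord]; trivial
  have : Submodule.span k (Set.range (dualWord k (A := A))) ≤
      Subalgebra.toSubmodule (logStar k D).range := by
    rw [Submodule.span_le]
    rintro _ ⟨w, rfl⟩
    exact dualWord_mem_of_letters _ w fun a _ => hl _ a rfl
  exact this hP

/-! ### Friedrichs' criterion -/

theorem letter_mem_liePolynomials (a : A) : dualWord k [a] ∈ liePolynomials k A :=
  Submodule.mem_sInf.2 fun _ hV => hV.1 a

theorem commutator_mem_liePolynomials {P Q : NCDual k A} (hP : P ∈ liePolynomials k A)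
    (hQ : Q ∈ liePolynomials k A) : P * Q - Q * P ∈ liePolynomials k A :=
  Submodule.mem_sInf.2 fun V hV =>
    hV.2 P (Submodule.mem_sInf.1 hP V hV) Q (Submodule.mem_sInf.1 hQ V hV)

theorem liePolynomials_le {V : Submodule k (NCDual k A)} (hl : ∀ a, dualWord k [a] ∈ V)
    (hb : ∀ P ∈ V, ∀ Q ∈ V, P * Q - Q * P ∈ V) : liePolynomials k A ≤ V :=
  sInf_le ⟨hl, hb⟩

/-- The comultiplication of the concatenation algebra for which the letters are
primitive. -/
def freeComul (k A : Type*) [Field k] : NCDual k A →ₐ[k] NCDual k A ⊗[k] NCDual k A :=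
  liftLetters k fun a => dualWord k [a] ⊗ₜ 1 + 1 ⊗ₜ dualWord k [a]

/-- The antipode `a₁⋯aₙ ↦ (-1)ⁿ aₙ⋯a₁` of the concatenation algebra. -/
def antipode (k A : Type*) [Field k] : NCDual k A →ₗ[k] NCDual k A :=
  (MulOpposite.opLinearEquiv k).symm.toLinearMap ∘ₗ
    (liftLetters k fun a => MulOpposite.op (-dualWord k [a])).toLinearMap

theorem antipode_one : antipode k A 1 = 1 := by simp [antipode]

theorem antipode_mul_letter (P : NCDual k A) (a : A) :
    antipode k A (P * dualWord k [a]) = -(dualWord k [a] * antipode k A P) := by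
  simp [antipode]

/-- The derivation multiplying each word by its length. -/
def euler (k A : Type*) [Field k] : NCDual k A →ₗ[k] NCDual k A :=
  (wordBasis k A).constr k fun w => (w.length : k) • dualWord k w

theorem euler_dualWord (w : List A) :
    euler k A (dualWord k w) = (w.length : k) • dualWord k w := by
  rw [euler, ← wordBasis_apply, Module.Basis.constr_basis]
  simp

theorem euler_one : euler k A 1 = 0 := by
  rw [← dualWord_nil, euler_dualWord]
  simp

theorem euler_mul_letter (P : NCDual k A) (a : A) :
    euler k A (P * dualWord k [a]) = euler k A P * dualWord k [a] + P * dualWord k [a] := by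
  have : euler k A ∘ₗ LinearMap.mulRight k (dualWord k [a]) =
      LinearMap.mulRight k (dualWord k [a]) ∘ₗ euler k A +
        LinearMap.mulRight k (dualWord k [a]) := linearMap_ext fun w => by
    simp [← dualWord_append, euler_dualWord, add_smul]
  exact LinearMap.congr_fun this P

/-- The map `x ⊗ y ↦ f(x) g(y)`. Its composite with `freeComul` is the convolution of `f`
and `g`. -/
def mulMap (f g : NCDual k A →ₗ[k] NCDual k A) : NCDual k A ⊗[k] NCDual k A →ₗ[k] NCDual k A :=
  LinearMap.mul' k (NCDual k A) ∘ₗ TensorProduct.map f g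

@[simp]
theorem mulMap_tmul (f g : NCDual k A →ₗ[k] NCDual k A) (P Q : NCDual k A) :
    mulMap f g (P ⊗ₜ Q) = f P * g Q := by
  simp [mulMap]

theorem mulMap_antipode_id_mul (X : NCDual k A ⊗[k] NCDual k A) (a : A) :
    mulMap (antipode k A) LinearMap.id (X * (dualWord k [a] ⊗ₜ 1 + 1 ⊗ₜ dualWord k [a])) =
      mulMap (antipode k A) LinearMap.id X * dualWord k [a] -
        dualWord k [a] * mulMap (antipode k A) LinearMap.id X := by
  induction X with
  | zero => simp
  | add x y hx hy => rw [add_mul, map_add, hx, hy, map_add]; noncomm_ring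
  | tmul x y =>
    simp only [mul_add, Algebra.TensorProduct.tmul_mul_tmul, mul_one, map_add, mulMap_tmul,
      antipode_mul_letter, LinearMap.id_apply]
    noncomm_ring

theorem mulMap_antipode_euler_mul (X : NCDual k A ⊗[k] NCDual k A) (a : A) :
    mulMap (antipode k A) (euler k A) (X * (dualWord k [a] ⊗ₜ 1 + 1 ⊗ₜ dualWord k [a])) =
      mulMap (antipode k A) (euler k A) X * dualWord k [a] -
        dualWord k [a] * mulMap (antipode k A) (euler k A) X +
        mulMap (antipode k A) LinearMap.id X * dualWord k [a] := by
  induction X with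
  | zero => simp
  | add x y hx hy => rw [add_mul, map_add, hx, hy, map_add, map_add]; noncomm_ring
  | tmul x y =>
    simp only [mul_add, Algebra.TensorProduct.tmul_mul_tmul, mul_one, map_add, mulMap_tmul,
      antipode_mul_letter, LinearMap.id_apply, euler_mul_letter]
    noncomm_ring

theorem freeComul_mul_letter (P : NCDual k A) (a : A) :
    freeComul k A (P * dualWord k [a]) =
      freeComul k A P * (dualWord k [a] ⊗ₜ 1 + 1 ⊗ₜ dualWord k [a]) := by
  simp [freeComul]

/-- The convolution of the antipode with the identity is scalar on words (in fact it is the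
counit). -/
theorem antipode_convolution_id (w : List A) :
    ∃ c : k, mulMap (antipode k A) LinearMap.id (freeComul k A (dualWord k w)) = c • 1 := by
  induction w using List.reverseRecOn with
  | nil => exact ⟨1, by simp [dualWord_nil, Algebra.TensorProduct.one_def, antipode_one]⟩
  | append_singleton w a ih =>
    obtain ⟨c, hc⟩ := ih
    refine ⟨0, ?_⟩
    rw [dualWord_append, freeComul_mul_letter, mulMap_antipode_id_mul, hc]
    simp

/-- The Dynkin operator, the convolution of the antipode with the Euler derivation, takes values
in the Lie polynomials: on words it is given by left-normed brackets. -/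
theorem dynkin_mem_liePolynomials (P : NCDual k A) :
    mulMap (antipode k A) (euler k A) (freeComul k A P) ∈ liePolynomials k A := by
  have hP : P ∈ Submodule.span k (Set.range (dualWord k (A := A))) := by
    rw [span_range_dualWord]; trivial
  induction hP using Submodule.span_induction with
  | zero => simp
  | add x y _ _ hx hy => rw [map_add, map_add]; exact add_mem hx hy
  | smul c x _ hx => rw [map_smul, map_smul]; exact Submodule.smul_mem _ c hx
  | mem x hx =>
    obtain ⟨w, rfl⟩ := hx
    induction w using List.reverseRecOn with
    | nil => simp [dualWord_nil, Algebra.TensorProduct.one_def, euler_one]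
    | append_singleton w a ih =>
      obtain ⟨c, hc⟩ := antipode_convolution_id (k := k) w
      rw [dualWord_append, freeComul_mul_letter, mulMap_antipode_euler_mul, hc]
      refine add_mem (commutator_mem_liePolynomials ih (letter_mem_liePolynomials a)) ?_
      rw [smul_mul_assoc, one_mul]
      exact Submodule.smul_mem _ c (letter_mem_liePolynomials a)

/-- The span of the words of length `n`. -/
def lengthEq (k A : Type*) [Field k] (n : ℕ) : Submodule k (NCDual k A) :=
  Submodule.span k (dualWord k '' {w : List A | w.length = n})

theorem mul_mem_lengthEq {m n : ℕ} {P Q : NCDual k A} (hP : P ∈ lengthEq k A m)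
    (hQ : Q ∈ lengthEq k A n) : P * Q ∈ lengthEq k A (m + n) := by
  have h := Submodule.mul_mem_mul hP hQ
  rw [lengthEq, lengthEq, Submodule.span_mul_span] at h
  refine Submodule.span_le.2 ?_ h
  rintro _ ⟨_, ⟨u, hu, rfl⟩, _, ⟨v, hv, rfl⟩, rfl⟩
  refine Submodule.subset_span ⟨u ++ v, ?_, dualWord_append u v⟩
  rw [Set.mem_ofPred_eq, List.length_append, hu, hv]

/-- The space of Lie polynomials is homogeneous for the length. -/
theorem liePolynomials_le_span_homogeneous : liePolynomials k A ≤
    Submodule.span k {P | P ∈ liePolynomials k A ∧ ∃ n, P ∈ lengthEq k A n} := by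
  refine liePolynomials_le (fun a => Submodule.subset_span ⟨letter_mem_liePolynomials a, 1,
    Submodule.subset_span ⟨[a], rfl, rfl⟩⟩) fun P hP Q hQ => ?_
  induction hP, hQ using Submodule.span_induction₂ with
  | mem_mem x y hx hy =>
    obtain ⟨hx, m, hm⟩ := hx
    obtain ⟨hy, n, hn⟩ := hy
    refine Submodule.subset_span ⟨commutator_mem_liePolynomials hx hy, m + n,
      sub_mem (mul_mem_lengthEq hm hn) ?_⟩
    rw [add_comm]
    exact mul_mem_lengthEq hn hm
  | zero_left y hy => simp
  | zero_right x hx => simp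
  | add_left x y z _ _ _ hx hy =>
    rw [show (x + y) * z - z * (x + y) = (x * z - z * x) + (y * z - z * y) by noncomm_ring]
    exact add_mem hx hy
  | add_right x y z _ _ _ hx hy =>
    rw [show x * (y + z) - (y + z) * x = (x * y - y * x) + (x * z - z * x) by noncomm_ring]
    exact add_mem hx hy
  | smul_left r x y _ _ h =>
    rw [smul_mul_assoc, mul_smul_comm, ← smul_sub]
    exact Submodule.smul_mem _ r h
  | smul_right r x y _ _ h =>
    rw [smul_mul_assoc, mul_smul_comm, ← smul_sub]
    exact Submodule.smul_mem _ r h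

/-- The map dividing each nonempty word by its length. Since `0⁻¹ = 0`, the empty word goes to `0`. -/
def eulerInv (k A : Type*) [Field k] : NCDual k A →ₗ[k] NCDual k A :=
  (wordBasis k A).constr k fun w => (w.length : k)⁻¹ • dualWord k w

theorem eulerInv_dualWord (w : List A) :
    eulerInv k A (dualWord k w) = (w.length : k)⁻¹ • dualWord k w := by
  rw [eulerInv, ← wordBasis_apply, Module.Basis.constr_basis]
  simp

theorem eulerInv_of_mem_lengthEq {n : ℕ} {P : NCDual k A} (hP : P ∈ lengthEq k A n) :
    eulerInv k A P = (n : k)⁻¹ • P := by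
  induction hP using Submodule.span_induction with
  | mem x hx =>
    obtain ⟨w, rfl, rfl⟩ := hx
    exact eulerInv_dualWord w
  | zero => simp
  | add x y _ _ hx hy => rw [map_add, hx, hy, smul_add]
  | smul c x _ hx => rw [map_smul, hx, smul_comm]

theorem eulerInv_mem_liePolynomials {P : NCDual k A} (hP : P ∈ liePolynomials k A) :
    eulerInv k A P ∈ liePolynomials k A := by
  refine (Submodule.span_le (p := (liePolynomials k A).comap (eulerInv k A))).2 ?_
    (liePolynomials_le_span_homogeneous hP)
  rintro x ⟨hx, n, hn⟩
  rw [SetLike.mem_coe, Submodule.mem_comap, eulerInv_of_mem_lengthEq hn]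
  exact Submodule.smul_mem _ _ hx

/-- The counit: the coefficient of the empty word. -/
def counit (k A : Type*) [Field k] : NCDual k A →ₐ[k] k :=
  liftLetters k fun _ => 0

theorem counit_freeComul (P : NCDual k A) :
    Algebra.TensorProduct.lift (counit k A) (counit k A) (fun _ _ => Commute.all _ _)
      (freeComul k A P) = counit k A P := by
  have : (Algebra.TensorProduct.lift (counit k A) (counit k A) fun _ _ => Commute.all _ _).comp
      (freeComul k A) = counit k A := algHom_ext_letters fun a => by
    simp [freeComul, counit]
  exact AlgHom.congr_fun this P

theorem eulerInv_euler [CharZero k] (P : NCDual k A) :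
    eulerInv k A (euler k A P) = P - counit k A P • 1 := by
  have : eulerInv k A ∘ₗ euler k A =
      LinearMap.id - (counit k A).toLinearMap.smulRight 1 := linearMap_ext fun w => by
    cases w with
    | nil => simp [dualWord_nil, euler_one]
    | cons a w =>
      have h : ((a :: w).length : k) ≠ 0 := by
        exact_mod_cast (Nat.succ_ne_zero w.length)
      simp only [LinearMap.comp_apply, euler_dualWord, map_smul, eulerInv_dualWord, smul_smul,
        mul_inv_cancel₀ h, one_smul, LinearMap.sub_apply, LinearMap.id_apply,
        LinearMap.smulRight_apply, AlgHom.toLinearMap_apply]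
      rw [dualWord_cons a w, map_mul, counit, liftLetters_letter]
      simp
  exact LinearMap.congr_fun this P

/-- Friedrichs' criterion, in the direction that needs characteristic zero: on a primitive element
the Dynkin operator coincides with the Euler derivation, which is invertible. -/
theorem mem_liePolynomials_of_freeComul [CharZero k] {P : NCDual k A}
    (hP : freeComul k A P = P ⊗ₜ 1 + 1 ⊗ₜ P) : P ∈ liePolynomials k A := by
  have h0 : counit k A P = 0 := by
    have := counit_freeComul P
    rw [hP] at this
    simpa using this
  have h := dynkin_mem_liePolynomials P
  rw [hP, map_add, mulMap_tmul, mulMap_tmul, euler_one, antipode_one, mul_zero, zero_add,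
    one_mul] at h
  have := eulerInv_mem_liePolynomials h
  rwa [eulerInv_euler, h0, zero_smul, sub_zero] at this

/-! ### Transport along the logarithm -/

/-- `log*` is a homomorphism of coalgebras from the shuffle to the quasi-shuffle dual. -/
theorem comul_logStar [CharZero k] (D : QuasiShuffleDatum A) (P : NCDual k A) :
    comul k D (logStar k D P) =
      TensorProduct.map (logStar k D).toLinearMap (logStar k D).toLinearMap
        (freeComul k A P) := by
  have h : (liftLetters k (comulLetter k D)).comp (logStar k D) =
      (Algebra.TensorProduct.map (logStar k D) (logStar k D)).comp (freeComul k A) :=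
    algHom_ext_letters fun a => by
      have h := isPrimitive_logStarLetter (k := k) D a
      rw [IsPrimitive, comul_eq_liftLetters] at h
      simpa [logStar_letter, freeComul] using h
  rw [comul_eq_liftLetters]
  exact AlgHom.congr_fun h P

theorem isPrimitive_logStar_of_mem [CharZero k] (D : QuasiShuffleDatum A) {P : NCDual k A}
    (hP : P ∈ liePolynomials k A) : IsPrimitive D (logStar k D P) := by
  let V : Submodule k (NCDual k A) :=
    { carrier := {P | IsPrimitive D (logStar k D P)}
      zero_mem' := by simp [IsPrimitive]
      add_mem' := fun {P Q} hP hQ => by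
        simp only [Set.mem_ofPred_eq, IsPrimitive, map_add] at *
        rw [hP, hQ, TensorProduct.add_tmul, TensorProduct.tmul_add]
        abel
      smul_mem' := fun c P hP => by
        simp only [Set.mem_ofPred_eq, IsPrimitive, map_smul] at *
        rw [hP, smul_add, TensorProduct.smul_tmul', TensorProduct.tmul_smul] }
  refine liePolynomials_le (V := V) (fun a => ?_) (fun P hP Q hQ => ?_) hP
  · change IsPrimitive D (logStar k D (dualWord k [a]))
    rw [logStar_letter]
    exact isPrimitive_logStarLetter D a
  · change IsPrimitive D (logStar k D (P * Q - Q * P))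
    rw [map_sub, map_mul, map_mul]
    exact IsPrimitive.commutator hP hQ

theorem mem_liePolynomials_of_isPrimitive_logStar [CharZero k] (D : QuasiShuffleDatum A)
    {P : NCDual k A} (hP : IsPrimitive D (logStar k D P)) : P ∈ liePolynomials k A := by
  refine mem_liePolynomials_of_freeComul
    (TensorProduct.map_injective_of_flat_flat (logStar k D).toLinearMap
      (logStar k D).toLinearMap (logStar_injective D) (logStar_injective D) ?_)
  rw [← comul_logStar, hP]
  simp

end QuasiShuffle
end

theorem theorem4p2 (k : Subfield ℂ) {A : Type*} (D : QuasiShuffleDatum A) :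
    {x : NCDual k A | QuasiShuffle.IsPrimitive D x} =
      QuasiShuffle.logStar k D '' (QuasiShuffle.liePolynomials k A : Set (NCDual k A)) := by
  ext x
  constructor
  · intro hx
    obtain ⟨P, rfl⟩ := QuasiShuffle.logStar_surjective D x
    exact ⟨P, QuasiShuffle.mem_liePolynomials_of_isPrimitive_logStar D hx, rfl⟩
  · rintro ⟨P, hP, rfl⟩
    exact QuasiShuffle.isPrimitive_logStar_of_mem D hP
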